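/- Let $(\mathcal X,\mathcal F,\mu)$ be a probability space with a filtration $\{\emptyset,\mathcal X\}=\mathcal F_0\subseteq\mathcal F_1\subseteq\dots\subseteq\mathcal F$, let $1<p<\infty$, and write $f_n=\mathbb E^\mu[f\,|\,\mathcal F_n]$ and $f^*=\sup_{n\ge 0}|f_n|$. For real numbers $F,\mathbf f$ put $$\widetilde{\mathcal B}_\mu^{\mathcal F}(F,\mathbf f)=\sup\left\{\mathbb E^\mu\left[|f^*|^p\right]: 0\le f\in L^p(\mathcal X,\mathcal F,\mu),\ \mathbb E^\mu[f^p]=F,\ \mathbb E^\mu[f]=\mathbf f\right\}.$$ For $M,C\ge 0$ let $\mathcal B_\mu^{\mathcal F}(F,\mathbf f,M;C)$ be the supremum of $\mathbb E^\mu\left[\sum_{n\ge0}\alpha_nf_n^p\right]$ over all $0\le f\in L^p(\mathcal X,\mathcal F,\mu)$ with $\mathbb E^\mu[f^p]=F$ and $\mathbb E^\mu[f]=\mathbf f$, and all sequences of non-negative $\mathcal F_n$-measurable random variables $\alpha_n$, $n\ge0$, with $\mathbb E^\mu\left[\sum_{n\ge0}\alpha_n\right]=M$ and $\mathbb E^\mu\left[\sum_{k\ge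 n}\alpha_k\,|\,\mathcal F_n\right]\le C$ almost surely for every $n\ge0$. Both suprema are taken in $[0,\infty]$, with $\sup\emptyset=0$. Then $$\widetilde{\mathcal B}_\mu^{\mathcal F}(F,\mathbf f)\le\mathcal B_\mu^{\mathcal F}(F,\mathbf f,1;C=1).$$ Moreover, if $\{\mathcal F_n\}_{n\ge0}$ is an infinitely refining filtration, i.e. for every $\varepsilon>0$, every $n\ge0$ and every $E\in\mathcal F_n$ there are $k>n$ and an integrable real-valued $\mathcal F_k$-measurable random variable $h$ with $|h\mathbf 1_E|=\mathbf 1_E$ and $\int_E|h_n|\,d\mu\le\varepsilon$, then $$\widetilde{\mathcal B}_\mu^{\mathcal F}(F,\mathbf f)=\mathcal B_\mu^{\mathcal F}(F,\mathbf f,1;C=1).$$ -/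

import Mathlib

open MeasureTheory
open scoped NNReal ENNReal

namespace DoobBellman

variable {Ω : Type*} {m : MeasurableSpace Ω}

/-- A sequence of nonnegative random variables `α n`, each `ℱ n`-measurable, is a Carleson sequence
with constant `C` if `E[∑_{k ≥ n} α k | ℱ n] ≤ C` almost surely for every `n`. The sum and the
conditional expectation are taken in `[0, ∞]`. -/
structure IsCarleson (μ : Measure Ω) (ℱ : Filtration ℕ m) (C : ℝ≥0) (α : ℕ → Ω → ℝ≥0) : Prop where
  adapted : ∀ n, Measurable[ℱ n] (α n)
  bound : ∀ n, ∀ᵐ x ∂μ, (μ⁻[fun y => ∑' j, (α (n + j) y : ℝ≥0∞)|ℱ n]) x ≤ (C : ℝ≥0∞)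

/-- The filtration `ℱ` is infinitely refining: for every `ε > 0`, every `n` and every `E ∈ ℱ n`
there are `k > n` and a real-valued (integrable) `ℱ k`-measurable `h` with `|h 1_E| = 1_E` and
`∫_E |E[h | ℱ n]| dμ ≤ ε`. Integrability is what makes `E[h | ℱ n]` meaningful. -/
def IsInfinitelyRefining (μ : Measure Ω) (ℱ : Filtration ℕ m) : Prop :=
  ∀ ε : ℝ, 0 < ε → ∀ n : ℕ, ∀ E : Set Ω, MeasurableSet[ℱ n] E →
    ∃ k : ℕ, n < k ∧ ∃ h : Ω → ℝ, Measurable[ℱ k] h ∧ Integrable h μ ∧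
      (∀ x, |E.indicator h x| = E.indicator 1 x) ∧ ∫ x in E, |(μ[h|ℱ n]) x| ∂μ ≤ ε

/-- `f ∈ L^p` is nonnegative with `E[f^p] = F` and `E[f] = a`. -/
structure HasMoments (μ : Measure Ω) (p F a : ℝ) (f : Ω → ℝ) : Prop where
  memLp : MemLp f (ENNReal.ofReal p) μ
  nonneg : 0 ≤ᵐ[μ] f
  moment : ∫ x, f x ^ p ∂μ = F
  mean : ∫ x, f x ∂μ = a

/-- The maximal function `f^* = sup_n |f_n|`, where `f_n = E[f | ℱ n]`, with values in `[0, ∞]`. -/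
noncomputable def maximalFunction (μ : Measure Ω) (ℱ : Filtration ℕ m) (f : Ω → ℝ) (x : Ω) : ℝ≥0∞ :=
  ⨆ n, ‖(μ[f|ℱ n]) x‖ₑ

/-- The Bellman function of the martingale Carleson embedding theorem: the supremum of
`E[∑ α_n f_n^p]` over nonnegative `f` with `E[f^p] = F`, `E[f] = a`, and over Carleson sequences
`α` with constant `C` and `E[∑ α_n] = M`. (Here `f_n ≥ 0` almost surely, so `f_n^p = |f_n|^p`.) -/
noncomputable def carlesonBellman (μ : Measure Ω) (ℱ : Filtration ℕ m) (p F a : ℝ) (M C : ℝ≥0) :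
    ℝ≥0∞ :=
  sSup {v : ℝ≥0∞ | ∃ (f : Ω → ℝ) (α : ℕ → Ω → ℝ≥0), HasMoments μ p F a f ∧
    IsCarleson μ ℱ C α ∧ ∫⁻ x, ∑' n, (α n x : ℝ≥0∞) ∂μ = M ∧
    v = ∫⁻ x, ∑' n, (α n x : ℝ≥0∞) * ‖(μ[f|ℱ n]) x‖ₑ ^ p ∂μ}

/-- The Bellman function of Doob's maximal inequality: the supremum of `E[(f^*)^p]` over
nonnegative `f` with `E[f^p] = F` and `E[f] = a`. -/
noncomputable def maximalBellman (μ : Measure Ω) (ℱ : Filtration ℕ m) (p F a : ℝ) : ℝ≥0∞ :=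
  sSup {v : ℝ≥0∞ | ∃ f : Ω → ℝ, HasMoments μ p F a f ∧
    v = ∫⁻ x, maximalFunction μ ℱ f x ^ p ∂μ}

end DoobBellman

namespace DoobBellman

section Auxiliary

variable {Ω : Type*} {m : MeasurableSpace Ω} {μ : Measure Ω}

/-! Put `g n = |f_n|^p`, so `(f^*)^p` is the supremum of the `g n`; both inequalities keep the same
`f`. For `≤`, choose at each point an index attaining the maximum of `g 0, ..., g N`. This choice
looks into the future, but projecting its indicators `ψ n` onto `ℱ n` gives a Carleson sequence of
constant and mass 1, with unchanged integrals against `g n` (`exists_isCarleson_of_tsum_eq_one`).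
For `≥`, sum by parts against the running maximum: its increments are adapted and nonnegative, so
each meets a Carleson tail of conditional mean at most `C` (`IsCarleson.lintegral_tsum_mul_le`). -/

lemma lintegral_mul_condLExp {Ω : Type*} {m' m : MeasurableSpace Ω} {μ : Measure[m] Ω}
    [IsFiniteMeasure μ] (hm : m' ≤ m)
    {X : Ω → ℝ≥0∞} (hX : Measurable X) {d : Ω → ℝ≥0∞} (hd : Measurable[m'] d) :
    ∫⁻ x, d x * (μ⁻[X|m']) x ∂μ = ∫⁻ x, d x * X x ∂μ := by
  have hE : Measurable (μ⁻[X|m']) := measurable_condLExp' m' μ X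
  refine Measurable.ennreal_induction (mα := m')
    (motive := fun d => ∫⁻ x, d x * (μ⁻[X|m']) x ∂μ = ∫⁻ x, d x * X x ∂μ) ?_ ?_ ?_ hd
  · intro c s hs
    have key (Y : Ω → ℝ≥0∞) (hY : Measurable Y) :
        ∫⁻ x, s.indicator (fun _ => c) x * Y x ∂μ = c * ∫⁻ x in s, Y x ∂μ := by
      rw [← lintegral_const_mul _ hY, ← lintegral_indicator (hm s hs)]
      refine lintegral_congr fun x => ?_
      by_cases hx : x ∈ s <;> simp [hx]
    rw [key _ hE, key _ hX, setLIntegral_condLExp hm μ X hs]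
  · intro u v _ hu _ ihu ihv
    have key (Y : Ω → ℝ≥0∞) (hY : Measurable Y) :
        ∫⁻ x, (u + v) x * Y x ∂μ = ∫⁻ x, u x * Y x ∂μ + ∫⁻ x, v x * Y x ∂μ := by
      simp only [Pi.add_apply, add_mul]
      exact lintegral_add_left ((hu.mono hm le_rfl).mul hY) _
    rw [key _ hE, key _ hX, ihu, ihv]
  · intro u hu hmono ih
    have key (Y : Ω → ℝ≥0∞) (hY : Measurable Y) :
        ∫⁻ x, (⨆ n, u n x) * Y x ∂μ = ⨆ n, ∫⁻ x, u n x * Y x ∂μ := by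
      simp only [ENNReal.iSup_mul]
      exact lintegral_iSup (fun n => ((hu n).mono hm le_rfl).mul hY)
        fun i j hij x => mul_le_mul_left (hmono hij x) _
    rw [key _ hE, key _ hX]
    exact iSup_congr ih

/-- Abel summation: both sides sum `d k * a n` over `k ≤ n`. -/
lemma tsum_mul_sum_range_succ (a d : ℕ → ℝ≥0∞) :
    ∑' n, a n * ∑ k ∈ Finset.range (n + 1), d k = ∑' k, d k * ∑' j, a (k + j) := by
  have h1 (n : ℕ) : a n * ∑ k ∈ Finset.range (n + 1), d k
      = ∑' k, if k ≤ n then d k * a n else 0 := by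
    rw [tsum_eq_sum (s := Finset.range (n + 1)), Finset.mul_sum]
    · refine Finset.sum_congr rfl fun k hk => ?_
      rw [if_pos (Nat.lt_succ_iff.1 (Finset.mem_range.1 hk)), mul_comm]
    · intro k hk
      rw [if_neg fun h => hk (Finset.mem_range.2 (Nat.lt_succ_of_le h))]
  have h2 (k : ℕ) : d k * ∑' j, a (k + j) = ∑' n, if k ≤ n then d k * a n else 0 := by
    rw [← ENNReal.tsum_mul_left]
    refine (add_right_injective k).tsum_eq (f := fun n => if k ≤ n then d k * a n else 0) ?_ ▸ ?_
    · intro n hn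
      have : k ≤ n := by
        by_contra h
        simp [h] at hn
      exact ⟨n - k, by simp [this]⟩
    · simp
  simp_rw [h1, h2]
  exact ENNReal.tsum_comm

/-- A Carleson sequence with constant `C` integrates an adapted process against at most `C` times
the integral of its supremum. -/
lemma IsCarleson.lintegral_tsum_mul_le [IsFiniteMeasure μ] {ℱ : Filtration ℕ m} {C : ℝ≥0}
    {α : ℕ → Ω → ℝ≥0} (hα : IsCarleson μ ℱ C α) {g : ℕ → Ω → ℝ≥0∞}
    (hg : ∀ n, Measurable[ℱ n] (g n)) :
    ∫⁻ x, ∑' n, (α n x : ℝ≥0∞) * g n x ∂μ ≤ C * ∫⁻ x, ⨆ n, g n x ∂μ := by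
  have hαm (n : ℕ) : Measurable (α n) := (hα.adapted n).mono (ℱ.le n) le_rfl
  set G : ℕ → Ω → ℝ≥0∞ := fun n x => partialSups (fun k => g k x) n with hG
  -- Since `G` is increasing in `n`, these truncated differences telescope even at the value `∞`.
  set d : ℕ → Ω → ℝ≥0∞ := fun n => Nat.casesOn n (G 0) fun k x => G (k + 1) x - G k x with hd
  have hGm (n : ℕ) : Measurable[ℱ n] (G n) := by
    induction n with
    | zero => simpa [hG] using hg 0
    | succ n ih =>
      have : G (n + 1) = fun x => G n x ⊔ g (n + 1) x := by
        funext x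
        simp [hG, partialSups_add_one]
      rw [this]
      exact (ih.mono (ℱ.mono n.le_succ) le_rfl).sup (hg (n + 1))
  have hdm (n : ℕ) : Measurable[ℱ n] (d n) := by
    cases n with
    | zero => exact hGm 0
    | succ n => exact (hGm (n + 1)).sub ((hGm n).mono (ℱ.mono n.le_succ) le_rfl)
  have hsum (n : ℕ) (x : Ω) : ∑ k ∈ Finset.range (n + 1), d k x = G n x := by
    induction n with
    | zero => simp [hd]
    | succ n ih =>
      rw [Finset.sum_range_succ, ih]
      exact add_tsub_cancel_of_le ((partialSups fun k => g k x).monotone n.le_succ)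
  have hA (n : ℕ) : Measurable fun y => ∑' j, (α (n + j) y : ℝ≥0∞) :=
    Measurable.tsum fun j => (hαm _).coe_nnreal_ennreal
  have hdm' (n : ℕ) : Measurable (d n) := (hdm n).mono (ℱ.le n) le_rfl
  calc ∫⁻ x, ∑' n, (α n x : ℝ≥0∞) * g n x ∂μ
      ≤ ∫⁻ x, ∑' n, (α n x : ℝ≥0∞) * G n x ∂μ := by
        refine lintegral_mono fun x => ENNReal.tsum_le_tsum fun n => ?_
        gcongr
        exact le_partialSups (fun k => g k x) n
    _ = ∑' n, ∫⁻ x, d n x * ∑' j, (α (n + j) x : ℝ≥0∞) ∂μ := by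
        rw [← lintegral_tsum (f := fun n x => d n x * ∑' j, (α (n + j) x : ℝ≥0∞))
          fun n => ((hdm' n).mul (hA n)).aemeasurable]
        refine lintegral_congr fun x => ?_
        simp_rw [← hsum]
        exact tsum_mul_sum_range_succ _ _
    _ ≤ ∑' n, C * ∫⁻ x, d n x ∂μ := by
        refine ENNReal.tsum_le_tsum fun n => ?_
        rw [← lintegral_mul_condLExp (ℱ.le n) (hA n) (hdm n), ← lintegral_const_mul _ (hdm' n)]
        refine lintegral_mono_ae ?_
        filter_upwards [hα.bound n] with x hx
        rw [mul_comm]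
        gcongr
    _ ≤ C * ∫⁻ x, ⨆ n, g n x ∂μ := by
        rw [ENNReal.tsum_mul_left, ← lintegral_tsum fun n => (hdm' n).aemeasurable]
        gcongr with x
        rw [ENNReal.tsum_eq_iSup_nat' (Filter.tendsto_add_atTop_nat 1)]
        refine iSup_le fun n => ?_
        rw [hsum]
        exact partialSups_le _ _ _ fun k _ => le_iSup (fun k => g k x) k

/-- The projections `E[ψ n | ℱ n]` of a partition of unity form a Carleson sequence. -/
lemma exists_isCarleson_of_tsum_eq_one [IsFiniteMeasure μ] (ℱ : Filtration ℕ m)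
    {ψ : ℕ → Ω → ℝ≥0∞} (hψ : ∀ n, Measurable (ψ n)) (hsum : ∀ x, ∑' n, ψ n x = 1) :
    ∃ α : ℕ → Ω → ℝ≥0, IsCarleson μ ℱ 1 α ∧ ∀ n (d : Ω → ℝ≥0∞), Measurable[ℱ n] d →
      ∫⁻ x, α n x * d x ∂μ = ∫⁻ x, ψ n x * d x ∂μ := by
  -- `toNNReal` sends `∞` to `0`, which matters only on a null set because `ψ n ≤ 1`.
  set α : ℕ → Ω → ℝ≥0 := fun n x => ((μ⁻[ψ n|ℱ n]) x).toNNReal with hαdef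
  have hαm (n : ℕ) : Measurable[ℱ n] (α n) := (measurable_condLExp (ℱ n) μ (ψ n)).ennreal_toNNReal
  have hle (n : ℕ) (x : Ω) : ψ n x ≤ 1 := hsum x ▸ ENNReal.le_tsum n
  have hae (n : ℕ) : ∀ᵐ x ∂μ, (α n x : ℝ≥0∞) = (μ⁻[ψ n|ℱ n]) x := by
    have hfin : ∫⁻ x, ψ n x ∂μ ≠ ∞ :=
      ((lintegral_mono (hle n)).trans_lt (by simp)).ne
    filter_upwards [condLExp_ne_top (mΩ := ℱ n) hfin] with x hx
    exact ENNReal.coe_toNNReal hx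
  have hint (n : ℕ) (d : Ω → ℝ≥0∞) (hd : Measurable[ℱ n] d) :
      ∫⁻ x, α n x * d x ∂μ = ∫⁻ x, ψ n x * d x ∂μ := by
    simp_rw [mul_comm _ (d _)]
    rw [← lintegral_mul_condLExp (ℱ.le n) (hψ n) hd]
    refine lintegral_congr_ae ?_
    filter_upwards [hae n] with x hx
    rw [hx]
  refine ⟨α, ⟨hαm, fun n => ?_⟩, hint⟩
  refine ae_le_of_ae_le_trim (hm := ℱ.le n) (f₂ := fun _ => ((1 : ℝ≥0) : ℝ≥0∞)) ?_
  refine ae_le_of_forall_setLIntegral_le_of_sigmaFinite (measurable_condLExp _ _ _) fun s hs _ => ?_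
  rw [setLIntegral_condLExp_trim (ℱ.le n) μ _ hs, setLIntegral_trim (ℱ.le n) measurable_const hs,
    lintegral_tsum fun j =>
      ((hαm (n + j)).mono (ℱ.le _) le_rfl).coe_nnreal_ennreal.aemeasurable.restrict]
  -- A set of `ℱ n` also lies in `ℱ (n + j)`, so on it the tail of `α` integrates like that of `ψ`,
  -- which is at most 1.
  have hset (j : ℕ) : ∫⁻ x in s, (α (n + j) x : ℝ≥0∞) ∂μ = ∫⁻ x in s, ψ (n + j) x ∂μ := by
    have hs' : MeasurableSet[ℱ (n + j)] s := ℱ.mono (Nat.le_add_right n j) s hs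
    have key := hint (n + j) (s.indicator 1) (Measurable.indicator (@measurable_one _ _ _ (ℱ (n + j)) _) hs')
    have hrw (u : Ω → ℝ≥0∞) : ∫⁻ x, u x * s.indicator 1 x ∂μ = ∫⁻ x in s, u x ∂μ := by
      rw [← lintegral_indicator (ℱ.le n s hs)]
      refine lintegral_congr fun x => ?_
      by_cases hx : x ∈ s <;> simp [hx]
    rwa [hrw, hrw] at key
  simp_rw [hset]
  rw [← lintegral_tsum fun j => (hψ _).aemeasurable.restrict]
  refine lintegral_mono fun x => ?_
  rw [ENNReal.coe_one, ← hsum x]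
  exact ENNReal.tsum_comp_le_tsum_of_injective (add_right_injective n) (fun k => ψ k x)

/-- The maximum of finitely many functions is attained along a measurable partition. -/
lemma exists_partition_max_le {g : ℕ → Ω → ℝ≥0∞} (hg : ∀ n, Measurable (g n)) (N : ℕ) :
    ∃ ψ : ℕ → Ω → ℝ≥0∞, (∀ n, Measurable (ψ n)) ∧ (∀ x, ∑' n, ψ n x = 1) ∧
      ∀ x, partialSups (fun k => g k x) N ≤ ∑' n, ψ n x * g n x := by
  -- `disjointed S` selects the least such index, which is at most `N`.
  set S : ℕ → Set Ω := fun n => {x | ∀ k ≤ N, g k x ≤ g n x} with hS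
  have hSm (n : ℕ) : MeasurableSet (S n) := by
    simp only [hS, Set.ofPred_forall]
    exact MeasurableSet.iInter fun k => MeasurableSet.iInter fun _ =>
      measurableSet_le (hg k) (hg n)
  have hmem (x : Ω) : ∃ n, x ∈ disjointed S n := by
    obtain ⟨n, -, hn⟩ := Finset.exists_max_image (Finset.range (N + 1)) (fun k => g k x) ⟨0, by simp⟩
    have : x ∈ ⋃ n, disjointed S n := by
      rw [iUnion_disjointed]
      exact Set.mem_iUnion.2 ⟨n, fun k hk => hn k (Finset.mem_range.2 (Nat.lt_succ_of_le hk))⟩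
    exact Set.mem_iUnion.1 this
  have hsingle (x : Ω) {n : ℕ} (hn : x ∈ disjointed S n) (c : ℕ → ℝ≥0∞) :
      ∑' k, (disjointed S k).indicator 1 x * c k = c n := by
    rw [tsum_eq_single n]
    · simp [hn]
    · intro k hk
      have : x ∉ disjointed S k := fun h =>
        Set.disjoint_left.1 (disjoint_disjointed S hk) h hn
      simp [this]
  refine ⟨fun n => (disjointed S n).indicator 1,
    fun n => measurable_one.indicator (MeasurableSet.disjointed hSm n), fun x => ?_, fun x => ?_⟩
  · obtain ⟨n, hn⟩ := hmem x
    simpa using hsingle x hn fun _ => 1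
  · obtain ⟨n, hn⟩ := hmem x
    rw [hsingle x hn fun k => g k x]
    exact partialSups_le _ _ _ fun k hk => disjointed_subset S n hn k hk

lemma maximalFunction_rpow (ℱ : Filtration ℕ m) {p : ℝ} (hp : 0 < p) (f : Ω → ℝ) (x : Ω) :
    maximalFunction μ ℱ f x ^ p = ⨆ n, ‖(μ[f|ℱ n]) x‖ₑ ^ p :=
  (ENNReal.orderIsoRpow p hp).map_iSup _

lemma measurable_enorm_condExp_rpow (ℱ : Filtration ℕ m) (p : ℝ) (f : Ω → ℝ) (n : ℕ) :
    Measurable[ℱ n] fun x => ‖(μ[f|ℱ n]) x‖ₑ ^ p :=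
  Measurable.pow_const (measurable_enorm.comp stronglyMeasurable_condExp.measurable) p

/-- For every filtration, refining or not, the Carleson Bellman function is dominated by `C` times
the maximal one: the same `f` serves, by summation by parts against the running maximum. -/
lemma carlesonBellman_le_maximalBellman [IsFiniteMeasure μ] (ℱ : Filtration ℕ m) {p : ℝ}
    (hp : 0 < p) (F a : ℝ) (M C : ℝ≥0) :
    carlesonBellman μ ℱ p F a M C ≤ C * maximalBellman μ ℱ p F a := by
  refine sSup_le ?_
  rintro _ ⟨f, α, hf, hα, -, rfl⟩
  refine (hα.lintegral_tsum_mul_le (measurable_enorm_condExp_rpow ℱ p f)).trans ?_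
  gcongr
  exact le_sSup ⟨f, hf, by simp_rw [maximalFunction_rpow ℱ hp]⟩

lemma maximalBellman_le_carlesonBellman [IsProbabilityMeasure μ] (ℱ : Filtration ℕ m) {p : ℝ}
    (hp : 0 < p) (F a : ℝ) :
    maximalBellman μ ℱ p F a ≤ carlesonBellman μ ℱ p F a 1 1 := by
  refine sSup_le ?_
  rintro _ ⟨f, hf, rfl⟩
  set g : ℕ → Ω → ℝ≥0∞ := fun n x => ‖(μ[f|ℱ n]) x‖ₑ ^ p with hg
  have hgm (n : ℕ) : Measurable[ℱ n] (g n) := measurable_enorm_condExp_rpow ℱ p f n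
  have hgm' (n : ℕ) : Measurable (g n) := (hgm n).mono (ℱ.le n) le_rfl
  have hsup (x : Ω) : maximalFunction μ ℱ f x ^ p = ⨆ N, partialSups (fun k => g k x) N := by
    rw [maximalFunction_rpow ℱ hp, iSup_partialSups_eq]
  have hpm (N : ℕ) : Measurable fun x => partialSups (fun k => g k x) N := by
    simp only [partialSups_apply]
    fun_prop
  simp_rw [hsup]
  -- The full supremum need not be attained, hence the reduction to finite maxima.
  rw [lintegral_iSup hpm fun i j hij x => (partialSups fun k => g k x).monotone hij]
  refine iSup_le fun N => ?_
  obtain ⟨ψ, hψ, hψ1, hmax⟩ := exists_partition_max_le hgm' N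
  obtain ⟨α, hα, hint⟩ := exists_isCarleson_of_tsum_eq_one (μ := μ) ℱ hψ hψ1
  have hαm (n : ℕ) : Measurable fun x => (α n x : ℝ≥0∞) :=
    ((hα.adapted n).mono (ℱ.le n) le_rfl).coe_nnreal_ennreal
  have hmass : ∫⁻ x, ∑' n, (α n x : ℝ≥0∞) ∂μ = (1 : ℝ≥0) := by
    have h (n : ℕ) : ∫⁻ x, (α n x : ℝ≥0∞) ∂μ = ∫⁻ x, ψ n x ∂μ := by
      simpa using hint n 1 (@measurable_one _ _ _ (ℱ n) _)
    rw [lintegral_tsum fun n => (hαm n).aemeasurable]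
    simp_rw [h]
    rw [← lintegral_tsum fun n => (hψ n).aemeasurable]
    simp [hψ1]
  refine le_trans ?_ (le_sSup ⟨f, α, hf, hα, hmass, rfl⟩)
  rw [lintegral_tsum (f := fun n x => (α n x : ℝ≥0∞) * g n x)
    fun n => ((hαm n).mul (hgm' n)).aemeasurable]
  simp_rw [fun n => hint n _ (hgm n)]
  rw [← lintegral_tsum (f := fun n x => ψ n x * g n x)
    fun n => ((hψ n).mul (hgm' n)).aemeasurable]
  exact lintegral_mono hmax

end Auxiliary

end DoobBellman

theorem theoremB {Ω : Type*} {m : MeasurableSpace Ω} (μ : Measure Ω) [IsProbabilityMeasure μ]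
    (ℱ : Filtration ℕ m) (hℱ : ℱ 0 = ⊥) (p : ℝ) (hp : 1 < p) (F a : ℝ) :
    DoobBellman.maximalBellman μ ℱ p F a ≤ DoobBellman.carlesonBellman μ ℱ p F a 1 1 ∧
    (DoobBellman.IsInfinitelyRefining μ ℱ →
      DoobBellman.maximalBellman μ ℱ p F a = DoobBellman.carlesonBellman μ ℱ p F a 1 1) := by
  have hp0 : 0 < p := zero_lt_one.trans hp
  have hle := DoobBellman.maximalBellman_le_carlesonBellman (μ := μ) ℱ hp0 F a
  refine ⟨hle, fun _ => le_antisymm hle ?_⟩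
  simpa using DoobBellman.carlesonBellman_le_maximalBellman (μ := μ) ℱ hp0 F a 1 1
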